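/- **Algebras.** A BL-algebra is an algebra $\langle A,\vee,\wedge,*,\to,0,1\rangle$ such that $\langle A,\vee,\wedge,0,1\rangle$ is a bounded lattice, $\langle A,*,1\rangle$ is a commutative monoid, $a*c\le b\iff c\le a\to b$, $a\wedge b=a*(a\to b)$ and $(a\to b)\vee(b\to a)=1$. A monadic BL-algebra is a BL-algebra with two unary operations $\exists,\forall$ satisfying $\forall x\to x\approx 1$, $\forall(x\to\forall y)\approx\exists x\to\forall y$, $\forall(\forall x\to y)\approx\forall x\to\forall y$, $\forall(\exists x\vee y)\approx\exists x\vee\forall y$ and $\exists(x*x)\approx\exists x*\exists x$. Let $\mathbb{MBL}$ be the class of monadic BL-algebras. **S5(BL).** Formulas are built from propositional variables $p_0,p_1,\dots$ with $\vee,\wedge,*,\to,0,1,\Box,\Diamond$; $\varphi\equiv\psi$ stands for $(\varphi\to\psi)\wedge(\psi\to\varphi)$. The axioms are those of Hájek's basic logic BL (where $\varphi\wedge\psi$, $\varphi\vee\psi$ and $1$ are defined by $\varphi*(\varphi\to\psi)$, $((\varphi\to\psi)\to\psi)\wedge((\psi\to\varphi)\to\varphi)$ and $0\to0$; the two implications between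 each symbol and its definition are taken as axioms) and, $\nu$ being any propositional combination of formulas beginning with $\Box$ or $\Diamond$, $\Box\varphi\to\varphi$; $\varphi\to\Diamond\varphi$; $\Box(\nu\to\varphi)\to(\nu\to\Box\varphi)$; $\Box(\varphi\to\nu)\to(\Diamond\varphi\to\nu)$; $\Box(\nu\vee\varphi)\to(\nu\vee\Box\varphi)$; $\Diamond(\varphi*\varphi)\equiv\Diamond\varphi*\Diamond\varphi$. The rules are modus ponens and necessitation $\varphi\vdash\Box\varphi$. **mBL$\forall$.** Formulas are the predicate formulas with unary predicates $P_0,P_1,\dots$, one object variable $x$ and no object constants. The axioms are those of BL and Hájek's quantifier axioms: $(\forall x)\varphi\to\varphi$; $\varphi\to(\exists x)\varphi$; for $\nu$ in which $x$ is not free, $(\forall x)(\nu\to\varphi)\to(\nu\to(\forall x)\varphi)$, $(\forall x)(\varphi\to\nu)\to((\exists x)\varphi\to\nu)$ and $(\forall x)(\nu\vee\varphi)\to(\nu\vee(\forall x)\varphi)$; and $(\exists x)(\varphi*\varphi)\equiv(\exists x)\varphi*(\exists x)\varphi$. The rules are modus ponens and generalization $\varphi\vdash(\forall x)\varphi$.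 In both logics $\Gamma\vdash\varphi$ means that $\varphi$ has a proof from the axioms and the members of $\Gamma$ by the rules, which apply to all derived formulas. For a set $E$ of equations between formulas, $E\models_{\mathbb{MBL}}\varphi\approx\psi$ means that every homomorphism from the formula algebra into a member of $\mathbb{MBL}$ (with $\Box,\Diamond$, respectively $(\forall x),(\exists x)$, interpreted by $\forall,\exists$) that satisfies all equations in $E$ satisfies $\varphi\approx\psi$. **Theorem.** $\mathbb{MBL}$ is a variety, and it is the equivalent algebraic semantics, in the sense of Blok and Pigozzi, of the deductive system S5(BL), with defining equation $x\approx1$ and equivalence formula $(x\to y)\wedge(y\to x)$. That is, $\vdash$ is a finitary, structural consequence relation, and for every set of formulas $\Gamma\cup\{\varphi,\psi\}$: 1. $\Gamma\vdash\varphi$ if and only if $\{\gamma\approx1:\gamma\in\Gamma\}\models_{\mathbb{MBL}}\varphi\approx1$; 2. $\{\varphi\approx\psi\}\models_{\mathbb{MBL}}(\varphi\to\psi)\wedge(\psi\to\varphi)\approx1$ and $\{(\varphi\to\psi)\wedge(\psi\to\varphi)\approx1\}\models_{\mathbb{MBL}}\varphi\approx\psi$. The same holds for mBL$\forall$: the translation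 $p_i\mapsto P_i(x)$, $\Box\mapsto(\forall x)$, $\Diamond\mapsto(\exists x)$ is a bijection between the formulas of the two logics that preserves and reflects $\Gamma\vdash\varphi$, and $\mathbb{MBL}$ is the equivalent algebraic semantics of mBL$\forall$, with the same defining equation and equivalence formula. -/

import Mathlib

universe u v

namespace MonadicBL

/-! ### Algebras of type (2,2,2,2,1,1,0,0) -/

/-- An algebra of the similarity type `∨, ∧, *, →, ∃, ∀, 0, 1`, no law being required. -/
class Alg (A : Type u) where
  vee : A → A → A
  wedge : A → A → A
  star : A → A → A
  imp : A → A → A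
  ex : A → A
  all : A → A
  zero : A
  one : A

infixr:60 " ⇒ₘ " => Alg.imp
infixl:65 " ⋎ₘ " => Alg.vee
infixl:66 " ⋏ₘ " => Alg.wedge
infixl:70 " ⊙ₘ " => Alg.star

/-- `a ≡ b` is `(a → b) ∧ (b → a)`. -/
def Alg.equi {A : Type u} [Alg A] (a b : A) : A := (a ⇒ₘ b) ⋏ₘ (b ⇒ₘ a)

/-- The lattice order, `a ≤ b` iff `a ∧ b = a`. -/
def Alg.le {A : Type u} [Alg A] (a b : A) : Prop := a ⋏ₘ b = a

/-- Homomorphisms of algebras of this type. -/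
structure IsHom {A : Type u} {B : Type v} [Alg A] [Alg B] (h : A → B) : Prop where
  map_vee : ∀ a b, h (a ⋎ₘ b) = h a ⋎ₘ h b
  map_wedge : ∀ a b, h (a ⋏ₘ b) = h a ⋏ₘ h b
  map_star : ∀ a b, h (a ⊙ₘ b) = h a ⊙ₘ h b
  map_imp : ∀ a b, h (a ⇒ₘ b) = (h a ⇒ₘ h b)
  map_ex : ∀ a, h (Alg.ex a) = Alg.ex (h a)
  map_all : ∀ a, h (Alg.all a) = Alg.all (h a)
  map_zero : h Alg.zero = Alg.zero
  map_one : h Alg.one = Alg.one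

/-- BL-algebras: bounded lattices with a commutative monoid structure whose unit is the top
element, satisfying residuation, divisibility and prelinearity. (The one-element algebra is
included.) -/
structure IsBL (A : Type u) [Alg A] : Prop where
  vee_comm : ∀ a b : A, a ⋎ₘ b = b ⋎ₘ a
  vee_assoc : ∀ a b c : A, (a ⋎ₘ b) ⋎ₘ c = a ⋎ₘ (b ⋎ₘ c)
  wedge_comm : ∀ a b : A, a ⋏ₘ b = b ⋏ₘ a
  wedge_assoc : ∀ a b c : A, (a ⋏ₘ b) ⋏ₘ c = a ⋏ₘ (b ⋏ₘ c)
  vee_wedge_self : ∀ a b : A, a ⋎ₘ (a ⋏ₘ b) = a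
  wedge_vee_self : ∀ a b : A, a ⋏ₘ (a ⋎ₘ b) = a
  zero_le : ∀ a : A, Alg.le Alg.zero a
  le_one : ∀ a : A, Alg.le a Alg.one
  star_comm : ∀ a b : A, a ⊙ₘ b = b ⊙ₘ a
  star_assoc : ∀ a b c : A, (a ⊙ₘ b) ⊙ₘ c = a ⊙ₘ (b ⊙ₘ c)
  one_star : ∀ a : A, Alg.one ⊙ₘ a = a
  residuation : ∀ a b c : A, Alg.le (a ⊙ₘ c) b ↔ Alg.le c (a ⇒ₘ b)
  divisibility : ∀ a b : A, a ⋏ₘ b = a ⊙ₘ (a ⇒ₘ b)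
  prelinearity : ∀ a b : A, (a ⇒ₘ b) ⋎ₘ (b ⇒ₘ a) = Alg.one

/-- Monadic BL-algebras. -/
structure IsMBL (A : Type u) [Alg A] : Prop extends IsBL A where
  m1 : ∀ x : A, (Alg.all x ⇒ₘ x) = Alg.one
  m2 : ∀ x y : A, Alg.all (x ⇒ₘ Alg.all y) = (Alg.ex x ⇒ₘ Alg.all y)
  m3 : ∀ x y : A, Alg.all (Alg.all x ⇒ₘ y) = (Alg.all x ⇒ₘ Alg.all y)
  m4 : ∀ x y : A, Alg.all (Alg.ex x ⋎ₘ y) = Alg.ex x ⋎ₘ Alg.all y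
  m5 : ∀ x : A, Alg.ex (x ⊙ₘ x) = Alg.ex x ⊙ₘ Alg.ex x

/-- The class `𝕄𝔹𝕃` of all monadic BL-algebras (with carriers in `Type u`). -/
def MBL (A : Type u) (_ : Alg A) : Prop := IsMBL A

/-! ### Terms and varieties -/

/-- Terms of the type `∨, ∧, *, →, ∃, ∀, 0, 1` in the variables `X`. -/
inductive Term (X : Type) : Type
  | var : X → Term X
  | vee : Term X → Term X → Term X
  | wedge : Term X → Term X → Term X
  | star : Term X → Term X → Term X
  | imp : Term X → Term X → Term X
  | ex : Term X → Term X
  | all : Term X → Term X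
  | zero : Term X
  | one : Term X

instance (X : Type) : Alg (Term X) where
  vee := Term.vee
  wedge := Term.wedge
  star := Term.star
  imp := Term.imp
  ex := Term.ex
  all := Term.all
  zero := Term.zero
  one := Term.one

/-- The value of a term in an algebra under an assignment. -/
def Term.eval {X : Type} {A : Type u} [Alg A] (e : X → A) : Term X → A
  | var i => e i
  | vee s t => s.eval e ⋎ₘ t.eval e
  | wedge s t => s.eval e ⋏ₘ t.eval e
  | star s t => s.eval e ⊙ₘ t.eval e
  | imp s t => s.eval e ⇒ₘ t.eval e
  | ex s => Alg.ex (s.eval e)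
  | all s => Alg.all (s.eval e)
  | zero => Alg.zero
  | one => Alg.one

/-- A class of algebras is a variety: it is defined by a set of identities. -/
def IsVariety (K : ∀ A : Type u, Alg A → Prop) : Prop :=
  ∃ E : Set (Term ℕ × Term ℕ), ∀ (A : Type u) (inst : Alg A),
    K A inst ↔ ∀ p ∈ E, ∀ e : ℕ → A, p.1.eval e = p.2.eval e

/-! ### Algebraization in the sense of Blok and Pigozzi

`F` stands for a formula algebra; a valuation in `A` is a homomorphism `F → A`, a substitution is
an endomorphism of `F`, an equation `φ ≈ ψ` is a pair `(φ, ψ)`. -/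

/-- The equational consequence relation `E ⊨_K φ ≈ ψ`. -/
def EqConseq {F : Type v} [Alg F] (K : ∀ A : Type u, Alg A → Prop)
    (E : Set (F × F)) (eqn : F × F) : Prop :=
  ∀ (A : Type u) (inst : Alg A), K A inst → ∀ h : F → A, IsHom h →
    (∀ p ∈ E, h p.1 = h p.2) → h eqn.1 = h eqn.2

/-- A deductive system: a finitary structural consequence relation on the formula algebra. -/
structure IsDeductiveSystem {F : Type v} [Alg F] (D : Set F → F → Prop) : Prop where
  refl : ∀ Γ φ, φ ∈ Γ → D Γ φ
  cut : ∀ Γ Θ φ, (∀ ψ ∈ Θ, D Γ ψ) → D Θ φ → D Γ φ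
  finitary : ∀ Γ φ, D Γ φ → ∃ Γ' ⊆ Γ, Γ'.Finite ∧ D Γ' φ
  structural : ∀ σ : F → F, IsHom σ → ∀ Γ φ, D Γ φ → D (σ '' Γ) (σ φ)

/-- The equations `δ(φ) ≈ ε(φ)`, for `δ ≈ ε` in `τ`. -/
def defEqs {F : Type v} [Alg F] (τ : Finset (Term (Fin 1) × Term (Fin 1))) (φ : F) :
    Set (F × F) :=
  {p | ∃ d ∈ τ, p = (d.1.eval (fun _ => φ), d.2.eval (fun _ => φ))}

/-- `K` is an equivalent algebraic semantics of the deductive system `D`, with the finite set `τ`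
of defining equations (in one variable) and the finite set `Δ` of equivalence formulas (in two
variables). -/
structure IsEquivAlgSemantics {F : Type v} [Alg F] (K : ∀ A : Type u, Alg A → Prop)
    (D : Set F → F → Prop) (τ : Finset (Term (Fin 1) × Term (Fin 1)))
    (Δ : Finset (Term (Fin 2))) : Prop where
  deductive : IsDeductiveSystem D
  algebraic : ∀ (Γ : Set F) (φ : F),
    D Γ φ ↔ ∀ eqn ∈ defEqs τ φ, EqConseq K (⋃ γ ∈ Γ, defEqs τ γ) eqn
  equiv_mp : ∀ φ ψ : F, ∀ t ∈ Δ, ∀ eqn ∈ defEqs τ (t.eval ![φ, ψ]), EqConseq K {(φ, ψ)} eqn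
  equiv_mpr : ∀ φ ψ : F, EqConseq K (⋃ t ∈ Δ, defEqs τ (t.eval ![φ, ψ])) (φ, ψ)

/-- The defining equation `x ≈ 1`. -/
def tauOne : Finset (Term (Fin 1) × Term (Fin 1)) := {(Term.var 0, Term.one)}

/-- The equivalence formula `(x → y) ∧ (y → x)`. -/
def deltaEqui : Finset (Term (Fin 2)) := {Alg.equi (Term.var 0) (Term.var 1)}

/-! ### Basic logic -/

/-- Instances of the axiom schemata of Hájek's basic logic BL: `a1`–`a7`, stated in terms of
`*`, `→`, `0`; the remaining schemata express the definitions
`φ ∧ ψ := φ * (φ → ψ)`, `φ ∨ ψ := ((φ → ψ) → ψ) ∧ ((ψ → φ) → φ)`, `1 := 0 → 0`,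
since here `∧`, `∨`, `1` are symbols of the language, as in the type of BL-algebras. -/
inductive BLAxiom {F : Type v} [Alg F] : F → Prop
  | a1 (φ ψ χ : F) : BLAxiom ((φ ⇒ₘ ψ) ⇒ₘ ((ψ ⇒ₘ χ) ⇒ₘ (φ ⇒ₘ χ)))
  | a2 (φ ψ : F) : BLAxiom ((φ ⊙ₘ ψ) ⇒ₘ φ)
  | a3 (φ ψ : F) : BLAxiom ((φ ⊙ₘ ψ) ⇒ₘ (ψ ⊙ₘ φ))
  | a4 (φ ψ : F) : BLAxiom ((φ ⊙ₘ (φ ⇒ₘ ψ)) ⇒ₘ (ψ ⊙ₘ (ψ ⇒ₘ φ)))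
  | a5a (φ ψ χ : F) : BLAxiom ((φ ⇒ₘ (ψ ⇒ₘ χ)) ⇒ₘ ((φ ⊙ₘ ψ) ⇒ₘ χ))
  | a5b (φ ψ χ : F) : BLAxiom (((φ ⊙ₘ ψ) ⇒ₘ χ) ⇒ₘ (φ ⇒ₘ (ψ ⇒ₘ χ)))
  | a6 (φ ψ χ : F) : BLAxiom (((φ ⇒ₘ ψ) ⇒ₘ χ) ⇒ₘ (((ψ ⇒ₘ φ) ⇒ₘ χ) ⇒ₘ χ))
  | a7 (φ : F) : BLAxiom (Alg.zero ⇒ₘ φ)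
  | wedge_mp (φ ψ : F) : BLAxiom ((φ ⋏ₘ ψ) ⇒ₘ (φ ⊙ₘ (φ ⇒ₘ ψ)))
  | wedge_mpr (φ ψ : F) : BLAxiom ((φ ⊙ₘ (φ ⇒ₘ ψ)) ⇒ₘ (φ ⋏ₘ ψ))
  | vee_mp (φ ψ : F) :
      BLAxiom ((φ ⋎ₘ ψ) ⇒ₘ (((φ ⇒ₘ ψ) ⇒ₘ ψ) ⋏ₘ ((ψ ⇒ₘ φ) ⇒ₘ φ)))
  | vee_mpr (φ ψ : F) :
      BLAxiom ((((φ ⇒ₘ ψ) ⇒ₘ ψ) ⋏ₘ ((ψ ⇒ₘ φ) ⇒ₘ φ)) ⇒ₘ (φ ⋎ₘ ψ))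
  | one_mp : BLAxiom (Alg.one ⇒ₘ (Alg.zero ⇒ₘ Alg.zero))
  | one_mpr : BLAxiom ((Alg.zero ⇒ₘ Alg.zero) ⇒ₘ Alg.one)

/-! ### The modal logic S5(BL) -/

/-- Modal formulas over the propositional variables `p₀, p₁, …`. -/
inductive Fm : Type
  | prop : ℕ → Fm
  | vee : Fm → Fm → Fm
  | wedge : Fm → Fm → Fm
  | star : Fm → Fm → Fm
  | imp : Fm → Fm → Fm
  | dia : Fm → Fm
  | box : Fm → Fm
  | zero : Fm
  | one : Fm

/-- The algebra of modal formulas; `◇` and `□` play the roles of `∃` and `∀`. -/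
instance : Alg Fm where
  vee := Fm.vee
  wedge := Fm.wedge
  star := Fm.star
  imp := Fm.imp
  ex := Fm.dia
  all := Fm.box
  zero := Fm.zero
  one := Fm.one

/-- Propositional combinations of formulas beginning with `□` or `◇`. -/
inductive Fm.IsModal : Fm → Prop
  | box (φ : Fm) : IsModal (Fm.box φ)
  | dia (φ : Fm) : IsModal (Fm.dia φ)
  | zero : IsModal Fm.zero
  | one : IsModal Fm.one
  | vee {φ ψ : Fm} : IsModal φ → IsModal ψ → IsModal (φ ⋎ₘ ψ)
  | wedge {φ ψ : Fm} : IsModal φ → IsModal ψ → IsModal (φ ⋏ₘ ψ)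
  | star {φ ψ : Fm} : IsModal φ → IsModal ψ → IsModal (φ ⊙ₘ ψ)
  | imp {φ ψ : Fm} : IsModal φ → IsModal ψ → IsModal (φ ⇒ₘ ψ)

/-- Instances of the modal axiom schemata of S5(BL). -/
inductive S5Axiom : Fm → Prop
  | box1 (φ : Fm) : S5Axiom (φ.box ⇒ₘ φ)
  | dia1 (φ : Fm) : S5Axiom (φ ⇒ₘ φ.dia)
  | box2 (ν φ : Fm) : ν.IsModal → S5Axiom ((ν ⇒ₘ φ).box ⇒ₘ (ν ⇒ₘ φ.box))
  | dia2 (ν φ : Fm) : ν.IsModal → S5Axiom ((φ ⇒ₘ ν).box ⇒ₘ (φ.dia ⇒ₘ ν))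
  | box3 (ν φ : Fm) : ν.IsModal → S5Axiom ((ν ⋎ₘ φ).box ⇒ₘ (ν ⋎ₘ φ.box))
  | dia3 (φ : Fm) : S5Axiom (Alg.equi (φ ⊙ₘ φ).dia (φ.dia ⊙ₘ φ.dia))

/-- `Γ ⊢ φ` in S5(BL), with the rules modus ponens and necessitation. -/
inductive S5 (Γ : Set Fm) : Fm → Prop
  | hyp {φ : Fm} : φ ∈ Γ → S5 Γ φ
  | bl {φ : Fm} : BLAxiom φ → S5 Γ φ
  | modal {φ : Fm} : S5Axiom φ → S5 Γ φ
  | mp {φ ψ : Fm} : S5 Γ φ → S5 Γ (φ ⇒ₘ ψ) → S5 Γ ψ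
  | nec {φ : Fm} : S5 Γ φ → S5 Γ φ.box

/-! ### The monadic predicate logic mBL∀ -/

/-- Predicate formulas with the unary predicates `P₀, P₁, …`, a single object variable `x` and no
object constants: `pred i` is `Pᵢ(x)`, `ex φ` is `(∃x)φ`, `all φ` is `(∀x)φ`. -/
inductive MonFm : Type
  | pred : ℕ → MonFm
  | vee : MonFm → MonFm → MonFm
  | wedge : MonFm → MonFm → MonFm
  | star : MonFm → MonFm → MonFm
  | imp : MonFm → MonFm → MonFm
  | ex : MonFm → MonFm
  | all : MonFm → MonFm
  | zero : MonFm
  | one : MonFm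

instance : Alg MonFm where
  vee := MonFm.vee
  wedge := MonFm.wedge
  star := MonFm.star
  imp := MonFm.imp
  ex := MonFm.ex
  all := MonFm.all
  zero := MonFm.zero
  one := MonFm.one

/-- The variable `x` occurs free in the formula. -/
def MonFm.XFree : MonFm → Prop
  | pred _ => True
  | vee φ ψ => φ.XFree ∨ ψ.XFree
  | wedge φ ψ => φ.XFree ∨ ψ.XFree
  | star φ ψ => φ.XFree ∨ ψ.XFree
  | imp φ ψ => φ.XFree ∨ ψ.XFree
  | ex _ => False
  | all _ => False
  | zero => False
  | one => False

/-- Instances of Hájek's quantifier axiom schemata for the monadic predicate logic mBL∀. -/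
inductive MonAxiom : MonFm → Prop
  | all1 (φ : MonFm) : MonAxiom (φ.all ⇒ₘ φ)
  | ex1 (φ : MonFm) : MonAxiom (φ ⇒ₘ φ.ex)
  | all2 (ν φ : MonFm) : ¬ ν.XFree → MonAxiom ((ν ⇒ₘ φ).all ⇒ₘ (ν ⇒ₘ φ.all))
  | ex2 (ν φ : MonFm) : ¬ ν.XFree → MonAxiom ((φ ⇒ₘ ν).all ⇒ₘ (φ.ex ⇒ₘ ν))
  | all3 (ν φ : MonFm) : ¬ ν.XFree → MonAxiom ((ν ⋎ₘ φ).all ⇒ₘ (ν ⋎ₘ φ.all))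
  | ex3 (φ : MonFm) : MonAxiom (Alg.equi (φ ⊙ₘ φ).ex (φ.ex ⊙ₘ φ.ex))

/-- `Γ ⊢ φ` in mBL∀, with the rules modus ponens and generalization. -/
inductive MonBL (Γ : Set MonFm) : MonFm → Prop
  | hyp {φ : MonFm} : φ ∈ Γ → MonBL Γ φ
  | bl {φ : MonFm} : BLAxiom φ → MonBL Γ φ
  | quant {φ : MonFm} : MonAxiom φ → MonBL Γ φ
  | mp {φ ψ : MonFm} : MonBL Γ φ → MonBL Γ (φ ⇒ₘ ψ) → MonBL Γ ψ
  | gen {φ : MonFm} : MonBL Γ φ → MonBL Γ φ.all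

/-- The translation of modal into monadic formulas: `pᵢ ↦ Pᵢ(x)`, `□ ↦ (∀x)`, `◇ ↦ (∃x)`. -/
def Fm.toMon : Fm → MonFm
  | prop i => MonFm.pred i
  | vee φ ψ => MonFm.vee φ.toMon ψ.toMon
  | wedge φ ψ => MonFm.wedge φ.toMon ψ.toMon
  | star φ ψ => MonFm.star φ.toMon ψ.toMon
  | imp φ ψ => MonFm.imp φ.toMon ψ.toMon
  | dia φ => MonFm.ex φ.toMon
  | box φ => MonFm.all φ.toMon
  | zero => MonFm.zero
  | one => MonFm.one

end MonadicBL

open MonadicBL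

/-! S5(BL) and mBL∀ are one calculus in two notations, `Derives`, formulated over any algebra of the
type. The side conditions on `ν` agree because, with a single object variable and no constants, a
formula without free `x` is exactly a propositional combination of quantified formulas
(`MonFm.not_xFree_iff`).

Soundness of `Derives` rests on the fixed points of `∀` in a monadic BL-algebra: they form a
subalgebra containing every value of `∃` and `∀` (`IsMBL.all_eq_of_modal`). Hence the value of `ν`
is fixed by `∀` and by `∃`, and the quantifier axioms are instances of `m1`–`m5` or of `a ≤ ∃a`.

Completeness is the Lindenbaum–Tarski construction. Formulas modulo provable equivalence over `Γ`
form a monadic BL-algebra (`Lindenbaum.isMBL`) in which the class of `1` consists of the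
consequences of `Γ`; the quotient map is therefore a valuation refuting every non-consequence. The
equivalence formula works because `a ≡ b` equals `1` in a BL-algebra only when `a = b`.

The class is a variety because residuation, its only non-equational axiom, can be replaced by
identities (`residuation_of_identities`). -/

namespace MonadicBL

/-! ### Order and arithmetic of BL-algebras -/

namespace IsBL

variable {A : Type u} [Alg A]

/-- The lattice order of a BL-algebra. -/
@[reducible] def toPartialOrder (H : IsBL A) : PartialOrder A where
  le a b := Alg.le a b
  le_refl a := by
    -- Idempotence of the meet follows from the two absorption laws.
    have h := H.wedge_vee_self a (a ⋏ₘ a)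
    rwa [H.vee_wedge_self] at h
  le_trans a b c hab hbc := by
    change a ⋏ₘ c = a
    change a ⋏ₘ b = a at hab
    change b ⋏ₘ c = b at hbc
    rw [← hab, H.wedge_assoc, hbc]
  le_antisymm a b hab hba := by
    change a ⋏ₘ b = a at hab
    change b ⋏ₘ a = b at hba
    rw [← hab, H.wedge_comm, hba]

theorem le_refl (H : IsBL A) (a : A) : Alg.le a a := H.toPartialOrder.le_refl a

theorem le_trans (H : IsBL A) {a b c : A} : Alg.le a b → Alg.le b c → Alg.le a c :=
  H.toPartialOrder.le_trans a b c

theorem le_antisymm (H : IsBL A) {a b : A} : Alg.le a b → Alg.le b a → a = b :=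
  H.toPartialOrder.le_antisymm a b

theorem wedge_le_left (H : IsBL A) (a b : A) : Alg.le (a ⋏ₘ b) a := by
  change (a ⋏ₘ b) ⋏ₘ a = a ⋏ₘ b
  rw [H.wedge_comm (a ⋏ₘ b) a, ← H.wedge_assoc, show a ⋏ₘ a = a from H.le_refl a]

theorem wedge_le_right (H : IsBL A) (a b : A) : Alg.le (a ⋏ₘ b) b := by
  rw [H.wedge_comm]
  exact H.wedge_le_left b a

theorem le_wedge (H : IsBL A) {a b c : A} (ha : Alg.le c a) (hb : Alg.le c b) :
    Alg.le c (a ⋏ₘ b) := by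
  change c ⋏ₘ (a ⋏ₘ b) = c
  rw [← H.wedge_assoc, show c ⋏ₘ a = c from ha, show c ⋏ₘ b = c from hb]

theorem le_vee_left (H : IsBL A) (a b : A) : Alg.le a (a ⋎ₘ b) := H.wedge_vee_self a b

theorem le_vee_right (H : IsBL A) (a b : A) : Alg.le b (a ⋎ₘ b) := by
  rw [H.vee_comm]
  exact H.le_vee_left b a

theorem vee_eq_of_le (H : IsBL A) {a b : A} (h : Alg.le a b) : a ⋎ₘ b = b := by
  have := H.vee_wedge_self b a
  rwa [H.wedge_comm, show a ⋏ₘ b = a from h, H.vee_comm] at this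

theorem vee_le (H : IsBL A) {a b c : A} (ha : Alg.le a c) (hb : Alg.le b c) :
    Alg.le (a ⋎ₘ b) c := by
  have : (a ⋎ₘ b) ⋎ₘ c = c := by
    rw [H.vee_assoc, H.vee_eq_of_le hb, H.vee_eq_of_le ha]
  have h := H.le_vee_left (a ⋎ₘ b) c
  rwa [this] at h

theorem star_one (H : IsBL A) (a : A) : a ⊙ₘ Alg.one = a := by rw [H.star_comm, H.one_star]

theorem imp_eq_one (H : IsBL A) {a b : A} : (a ⇒ₘ b) = Alg.one ↔ Alg.le a b := by
  constructor
  · intro h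
    have := (H.residuation a b Alg.one).2 (by rw [h]; exact H.le_refl _)
    rwa [H.star_one] at this
  · intro h
    refine H.le_antisymm (H.le_one _) ((H.residuation a b Alg.one).1 ?_)
    rwa [H.star_one]

theorem eq_one_of_le (H : IsBL A) {a : A} (h : Alg.le Alg.one a) : a = Alg.one :=
  H.le_antisymm (H.le_one _) h

theorem star_imp_le (H : IsBL A) (a b : A) : Alg.le (a ⊙ₘ (a ⇒ₘ b)) b :=
  (H.residuation _ _ _).2 (H.le_refl _)

theorem star_le_star_left (H : IsBL A) {b c : A} (a : A) (h : Alg.le b c) :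
    Alg.le (a ⊙ₘ b) (a ⊙ₘ c) :=
  (H.residuation _ _ _).2 (H.le_trans h ((H.residuation _ _ _).1 (H.le_refl _)))

theorem star_le_star (H : IsBL A) {a b c d : A} (h : Alg.le a b) (h' : Alg.le c d) :
    Alg.le (a ⊙ₘ c) (b ⊙ₘ d) := by
  refine H.le_trans (H.star_le_star_left a h') ?_
  rw [H.star_comm a, H.star_comm b]
  exact H.star_le_star_left d h

theorem star_le_left (H : IsBL A) (a b : A) : Alg.le (a ⊙ₘ b) a := by
  have := H.star_le_star_left a (H.le_one b)
  rwa [H.star_one] at this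

theorem imp_le_imp_right (H : IsBL A) {b c : A} (a : A) (h : Alg.le b c) :
    Alg.le (a ⇒ₘ b) (a ⇒ₘ c) :=
  (H.residuation _ _ _).1 (H.le_trans (H.star_imp_le a b) h)

theorem imp_imp (H : IsBL A) (a b c : A) : (a ⇒ₘ (b ⇒ₘ c)) = (a ⊙ₘ b ⇒ₘ c) := by
  apply H.le_antisymm
  · rw [← H.residuation, H.star_comm a b, H.star_assoc, H.residuation, H.residuation]
    exact H.le_refl _
  · rw [← H.residuation, ← H.residuation, ← H.star_assoc, H.star_comm b a, H.residuation]
    exact H.le_refl _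

/-- Case distinction along prelinearity. -/
theorem le_of_prelinear (H : IsBL A) {a b u c : A} (h : Alg.le (u ⊙ₘ (a ⇒ₘ b)) c)
    (h' : Alg.le (u ⊙ₘ (b ⇒ₘ a)) c) : Alg.le u c := by
  -- Residuation puts both `a → b` and `b → a` below `u → c`; their join is `1`.
  have := H.vee_le ((H.residuation _ _ _).1 h) ((H.residuation _ _ _).1 h')
  rw [H.prelinearity, ← H.residuation, H.star_one] at this
  exact this

/-- Residuation puts each of `a`, `b` below both meetands. Conversely, multiplying the meet by `a →
b` lands below `b`, and by `b → a` below `a`, so prelinearity bounds it by the join. -/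
theorem vee_eq (H : IsBL A) (a b : A) :
    a ⋎ₘ b = ((a ⇒ₘ b) ⇒ₘ b) ⋏ₘ ((b ⇒ₘ a) ⇒ₘ a) := by
  have key (x y : A) : Alg.le x ((x ⇒ₘ y) ⇒ₘ y) := by
    rw [← H.residuation, H.star_comm]
    exact H.star_imp_le x y
  have key' (x y : A) : Alg.le x ((y ⇒ₘ x) ⇒ₘ x) := by
    rw [← H.residuation, H.star_comm]
    exact H.star_le_left _ _
  apply H.le_antisymm
  · exact H.vee_le (H.le_wedge (key _ _) (key' _ _)) (H.le_wedge (key' _ _) (key _ _))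
  · refine H.le_of_prelinear (a := a) (b := b) ?_ ?_
    · rw [H.star_comm]
      exact H.le_trans (H.star_le_star_left _ (H.wedge_le_left _ _))
        (H.le_trans (H.star_imp_le _ _) (H.le_vee_right a b))
    · rw [H.star_comm]
      exact H.le_trans (H.star_le_star_left _ (H.wedge_le_right _ _))
        (H.le_trans (H.star_imp_le _ _) (H.le_vee_left a b))

theorem eq_one_of_blAxiom (H : IsBL A) {a : A} (h : BLAxiom a) : a = Alg.one := by
  cases h with
  | a1 a b c =>
    rw [H.imp_eq_one, ← H.residuation, ← H.residuation, H.star_comm (b ⇒ₘ c), ← H.star_assoc]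
    exact H.le_trans (H.star_le_star (H.star_imp_le a b) (H.le_refl _)) (H.star_imp_le b c)
  | a2 a b => exact H.imp_eq_one.2 (H.star_le_left a b)
  | a3 a b => rw [H.imp_eq_one, H.star_comm]; exact H.le_refl _
  | a4 a b =>
    rw [H.imp_eq_one, ← H.divisibility, ← H.divisibility, H.wedge_comm]; exact H.le_refl _
  | a5a a b c => rw [H.imp_eq_one, H.imp_imp]; exact H.le_refl _
  | a5b a b c => rw [H.imp_eq_one, H.imp_imp]; exact H.le_refl _
  | a6 a b c =>
    rw [H.imp_eq_one, ← H.residuation]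
    refine H.le_of_prelinear (a := a) (b := b) ?_ ?_
    · rw [H.star_assoc, H.star_comm]
      exact H.le_trans (H.star_le_left _ _) (by rw [H.star_comm]; exact H.star_imp_le _ _)
    · rw [H.star_comm _ ((a ⇒ₘ b) ⇒ₘ c), H.star_assoc, H.star_comm]
      exact H.le_trans (H.star_le_left _ _) (by rw [H.star_comm]; exact H.star_imp_le _ _)
  | a7 a => exact H.imp_eq_one.2 (H.zero_le a)
  | wedge_mp a b => rw [H.imp_eq_one, H.divisibility]; exact H.le_refl _
  | wedge_mpr a b => rw [H.imp_eq_one, H.divisibility]; exact H.le_refl _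
  | vee_mp a b => rw [H.imp_eq_one, ← H.vee_eq]; exact H.le_refl _
  | vee_mpr a b => rw [H.imp_eq_one, ← H.vee_eq]; exact H.le_refl _
  | one_mp => rw [H.imp_eq_one, H.imp_eq_one.2 (H.le_refl _)]; exact H.le_refl _
  | one_mpr => exact H.imp_eq_one.2 (H.le_one _)

theorem equi_eq_one (H : IsBL A) {a b : A} : Alg.equi a b = Alg.one ↔ a = b := by
  constructor
  · intro h
    have h1 := H.wedge_le_left (a ⇒ₘ b) (b ⇒ₘ a)
    have h2 := H.wedge_le_right (a ⇒ₘ b) (b ⇒ₘ a)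
    rw [show (a ⇒ₘ b) ⋏ₘ (b ⇒ₘ a) = Alg.one from h] at h1 h2
    exact H.le_antisymm (H.imp_eq_one.1 (H.eq_one_of_le h1)) (H.imp_eq_one.1 (H.eq_one_of_le h2))
  · rintro rfl
    unfold Alg.equi
    rw [H.imp_eq_one.2 (H.le_refl _)]
    exact H.le_refl _

/-- BL-algebras presented through a partial order. -/
theorem of_partialOrder [PartialOrder A]
    (vee_le : ∀ a b c : A, a ⋎ₘ b ≤ c ↔ a ≤ c ∧ b ≤ c)
    (le_wedge : ∀ a b c : A, c ≤ a ⋏ₘ b ↔ c ≤ a ∧ c ≤ b)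
    (zero_le : ∀ a : A, Alg.zero ≤ a) (le_one : ∀ a : A, a ≤ Alg.one)
    (star_comm : ∀ a b : A, a ⊙ₘ b = b ⊙ₘ a)
    (star_assoc : ∀ a b c : A, (a ⊙ₘ b) ⊙ₘ c = a ⊙ₘ (b ⊙ₘ c))
    (one_star : ∀ a : A, Alg.one ⊙ₘ a = a)
    (residuation : ∀ a b c : A, a ⊙ₘ c ≤ b ↔ c ≤ (a ⇒ₘ b))
    (divisibility : ∀ a b : A, a ⋏ₘ b = a ⊙ₘ (a ⇒ₘ b))
    (prelinearity : ∀ a b : A, (a ⇒ₘ b) ⋎ₘ (b ⇒ₘ a) = Alg.one) : IsBL A := by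
  -- The meet-defined order coincides with the given one, since meets are greatest lower bounds.
  have hle (a b : A) : Alg.le a b ↔ a ≤ b := by
    constructor
    · intro h
      exact ((le_wedge a b a).1 (le_of_eq (show a = a ⋏ₘ b from h.symm))).2
    · intro h
      exact _root_.le_antisymm ((le_wedge a b _).1 _root_.le_rfl).1
        ((le_wedge a b a).2 ⟨_root_.le_rfl, h⟩)
  refine
    { vee_comm := fun a b => ?_
      vee_assoc := fun a b c => ?_
      wedge_comm := fun a b => ?_
      wedge_assoc := fun a b c => ?_
      vee_wedge_self := fun a b => ?_
      wedge_vee_self := fun a b => (hle _ _).2 ((vee_le a b _).1 _root_.le_rfl).1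
      zero_le := fun a => (hle _ _).2 (zero_le a)
      le_one := fun a => (hle _ _).2 (le_one a)
      star_comm := star_comm
      star_assoc := star_assoc
      one_star := one_star
      residuation := fun a b c => by rw [hle, hle, residuation]
      divisibility := divisibility
      prelinearity := prelinearity }
  · exact eq_of_forall_ge_iff fun c => by rw [vee_le, vee_le, and_comm]
  · exact eq_of_forall_ge_iff fun d => by simp only [vee_le, and_assoc]
  · exact eq_of_forall_le_iff fun c => by rw [le_wedge, le_wedge, and_comm]
  · exact eq_of_forall_le_iff fun d => by simp only [le_wedge, and_assoc]
  · exact _root_.le_antisymm ((vee_le _ _ _).2 ⟨_root_.le_rfl, ((le_wedge a b _).1 _root_.le_rfl).1⟩)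
      ((vee_le _ _ _).1 _root_.le_rfl).1

end IsBL

/-! ### Modal elements -/

/-- The elements generated by the values of `∃` and `∀`. In a formula algebra these are the
propositional combinations of quantified formulas. -/
inductive Modal {F : Type v} [Alg F] : F → Prop
  | all (a : F) : Modal (Alg.all a)
  | ex (a : F) : Modal (Alg.ex a)
  | zero : Modal Alg.zero
  | one : Modal Alg.one
  | vee {a b : F} : Modal a → Modal b → Modal (a ⋎ₘ b)
  | wedge {a b : F} : Modal a → Modal b → Modal (a ⋏ₘ b)
  | star {a b : F} : Modal a → Modal b → Modal (a ⊙ₘ b)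
  | imp {a b : F} : Modal a → Modal b → Modal (a ⇒ₘ b)

/-- Transports the side condition on `ν` along valuations and substitutions. -/
theorem Modal.map {F : Type u} {G : Type v} [Alg F] [Alg G] {h : F → G} (hh : IsHom h) {a : F}
    (ha : Modal a) : Modal (h a) := by
  induction ha with
  | all a => rw [hh.map_all]; exact .all _
  | ex a => rw [hh.map_ex]; exact .ex _
  | zero => rw [hh.map_zero]; exact .zero
  | one => rw [hh.map_one]; exact .one
  | vee _ _ iha ihb => rw [hh.map_vee]; exact .vee iha ihb
  | wedge _ _ iha ihb => rw [hh.map_wedge]; exact .wedge iha ihb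
  | star _ _ iha ihb => rw [hh.map_star]; exact .star iha ihb
  | imp _ _ iha ihb => rw [hh.map_imp]; exact .imp iha ihb

theorem Alg.equi_map {F : Type u} {G : Type v} [Alg F] [Alg G] {h : F → G} (hh : IsHom h)
    (a b : F) : h (Alg.equi a b) = Alg.equi (h a) (h b) := by
  simp only [Alg.equi, hh.map_wedge, hh.map_imp]

theorem BLAxiom.map {F : Type u} {G : Type v} [Alg F] [Alg G] {h : F → G} (hh : IsHom h) {a : F}
    (ha : BLAxiom a) : BLAxiom (h a) := by
  cases ha <;>
    simp only [hh.map_vee, hh.map_wedge, hh.map_star, hh.map_imp, hh.map_zero, hh.map_one] <;>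
    constructor

namespace IsMBL

variable {A : Type u} [Alg A]

theorem all_le (H : IsMBL A) (a : A) : Alg.le (Alg.all a) a := H.imp_eq_one.1 (H.m1 a)

theorem all_one (H : IsMBL A) : Alg.all (Alg.one : A) = Alg.one := by
  have h := H.m3 Alg.one Alg.one
  rwa [H.m1, H.imp_eq_one.2 (H.le_refl _)] at h

/-- The hypothesis says `∀a → b = 1`; applying `∀` and moving it inwards by `m3` yields `∀a → ∀b =
1`. -/
theorem all_le_all_of_le (H : IsMBL A) {a b : A} (h : Alg.le (Alg.all a) b) :
    Alg.le (Alg.all a) (Alg.all b) := by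
  rw [← H.imp_eq_one, ← H.m3, H.imp_eq_one.2 h, H.all_one]

theorem all_all (H : IsMBL A) (a : A) : Alg.all (Alg.all a) = Alg.all a :=
  H.le_antisymm (H.all_le _) (H.all_le_all_of_le (H.le_refl _))

theorem all_zero (H : IsMBL A) : Alg.all (Alg.zero : A) = Alg.zero :=
  H.le_antisymm (H.all_le _) (H.zero_le _)

theorem vee_zero (H : IsMBL A) (a : A) : a ⋎ₘ Alg.zero = a := by
  rw [H.vee_comm, H.vee_eq_of_le (H.zero_le a)]

/-- This is `m4` with the second argument `0`. -/
theorem all_ex (H : IsMBL A) (a : A) : Alg.all (Alg.ex a) = Alg.ex a := by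
  have h := H.m4 a Alg.zero
  rwa [H.all_zero, H.vee_zero] at h

/-- Since `∃a` is a value of `∀`, `m2` gives `∀(a → ∃a) = (∃a → ∃a) = 1`, and `∀` is deflationary.
-/
theorem le_ex (H : IsMBL A) (a : A) : Alg.le a (Alg.ex a) := by
  have h := H.m2 a (Alg.ex a)
  rw [H.all_ex, H.imp_eq_one.2 (H.le_refl _)] at h
  have h' := H.all_le (a ⇒ₘ Alg.ex a)
  rw [h] at h'
  exact H.imp_eq_one.1 (H.eq_one_of_le h')

theorem ex_all (H : IsMBL A) (a : A) : Alg.ex (Alg.all a) = Alg.all a := by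
  refine H.le_antisymm ?_ (H.le_ex _)
  rw [← H.imp_eq_one, ← H.m2, H.imp_eq_one.2 (H.le_refl _), H.all_one]

/-- From `b ≤ a → a * b` and `∀b = b` follows `b ≤ ∀(a → a * b)`, which `m3` turns into `a → ∀(a *
b)` because `a = ∀a`; residuation finishes. -/
theorem all_star_of_all_eq (H : IsMBL A) {a b : A} (ha : Alg.all a = a) (hb : Alg.all b = b) :
    Alg.all (a ⊙ₘ b) = a ⊙ₘ b := by
  refine H.le_antisymm (H.all_le _) ?_
  have h : Alg.le (Alg.all b) (a ⇒ₘ a ⊙ₘ b) := by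
    rw [hb, ← H.residuation]; exact H.le_refl _
  have h' := H.all_le_all_of_le h
  rw [← ha, H.m3, ha, hb] at h'
  exact (H.residuation _ _ _).2 h'

theorem all_imp_of_all_eq (H : IsMBL A) {a b : A} (ha : Alg.all a = a) (hb : Alg.all b = b) :
    Alg.all (a ⇒ₘ b) = (a ⇒ₘ b) := by
  have h := H.m3 a b
  rwa [ha, hb] at h

/-- The elements `a` with `∀a = a` form a subalgebra. -/
theorem all_eq_of_modal (H : IsMBL A) {a : A} (h : Modal a) : Alg.all a = a := by
  induction h with
  | all a => exact H.all_all a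
  | ex a => exact H.all_ex a
  | zero => exact H.all_zero
  | one => exact H.all_one
  | @vee a b _ _ ha hb =>
    -- `m4` needs a value of `∃` on the left; `a = ∀a = ∃∀a` is one.
    have h := H.m4 (Alg.all a) b
    rwa [H.ex_all, ha, hb] at h
  | wedge _ _ ha hb =>
    -- Divisibility reduces the meet to product and implication.
    rw [H.divisibility]
    exact H.all_star_of_all_eq ha (H.all_imp_of_all_eq ha hb)
  | star _ _ ha hb => exact H.all_star_of_all_eq ha hb
  | imp _ _ ha hb => exact H.all_imp_of_all_eq ha hb

theorem ex_eq_of_modal (H : IsMBL A) {a : A} (h : Modal a) : Alg.ex a = a := by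
  rw [← H.all_eq_of_modal h, H.ex_all]

end IsMBL

/-! ### The common calculus of S5(BL) and mBL∀ -/

/-- The monadic axiom schemata over an arbitrary formula algebra. -/
inductive MonadicAxiom {F : Type v} [Alg F] : F → Prop
  | all1 (φ : F) : MonadicAxiom (Alg.all φ ⇒ₘ φ)
  | ex1 (φ : F) : MonadicAxiom (φ ⇒ₘ Alg.ex φ)
  | all2 (ν φ : F) : Modal ν → MonadicAxiom (Alg.all (ν ⇒ₘ φ) ⇒ₘ (ν ⇒ₘ Alg.all φ))
  | ex2 (ν φ : F) : Modal ν → MonadicAxiom (Alg.all (φ ⇒ₘ ν) ⇒ₘ (Alg.ex φ ⇒ₘ ν))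
  | all3 (ν φ : F) : Modal ν → MonadicAxiom (Alg.all (ν ⋎ₘ φ) ⇒ₘ (ν ⋎ₘ Alg.all φ))
  | ex3 (φ : F) : MonadicAxiom (Alg.equi (Alg.ex (φ ⊙ₘ φ)) (Alg.ex φ ⊙ₘ Alg.ex φ))

/-- Derivability from the BL-axioms and the monadic axioms by modus ponens and generalization. -/
inductive Derives {F : Type v} [Alg F] (Γ : Set F) : F → Prop
  | hyp {φ : F} : φ ∈ Γ → Derives Γ φ
  | bl {φ : F} : BLAxiom φ → Derives Γ φ
  | monadic {φ : F} : MonadicAxiom φ → Derives Γ φ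
  | mp {φ ψ : F} : Derives Γ φ → Derives Γ (φ ⇒ₘ ψ) → Derives Γ ψ
  | gen {φ : F} : Derives Γ φ → Derives Γ (Alg.all φ)

theorem MonadicAxiom.map {F : Type u} {G : Type v} [Alg F] [Alg G] {h : F → G} (hh : IsHom h)
    {a : F} (ha : MonadicAxiom a) : MonadicAxiom (h a) := by
  cases ha with
  | all1 φ => rw [hh.map_imp, hh.map_all]; exact .all1 _
  | ex1 φ => rw [hh.map_imp, hh.map_ex]; exact .ex1 _
  | all2 ν φ hν => simp only [hh.map_imp, hh.map_all]; exact .all2 _ _ (hν.map hh)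
  | ex2 ν φ hν => simp only [hh.map_imp, hh.map_all, hh.map_ex]; exact .ex2 _ _ (hν.map hh)
  | all3 ν φ hν => simp only [hh.map_imp, hh.map_all, hh.map_vee]; exact .all3 _ _ (hν.map hh)
  | ex3 φ => simp only [Alg.equi_map hh, hh.map_star, hh.map_ex]; exact .ex3 _

theorem IsMBL.eq_one_of_monadicAxiom {A : Type u} [Alg A] (H : IsMBL A) {a : A}
    (h : MonadicAxiom a) : a = Alg.one := by
  cases h with
  | all1 a => exact H.m1 a
  | ex1 a => exact H.imp_eq_one.2 (H.le_ex a)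
  | all2 n a hn =>
    have h := H.m3 n a
    rw [H.all_eq_of_modal hn] at h
    rw [h]; exact H.imp_eq_one.2 (H.le_refl _)
  | ex2 n a hn =>
    have h := H.m2 a n
    rw [H.all_eq_of_modal hn] at h
    rw [h]; exact H.imp_eq_one.2 (H.le_refl _)
  | all3 n a hn =>
    have h := H.m4 n a
    rw [H.ex_eq_of_modal hn] at h
    rw [h]; exact H.imp_eq_one.2 (H.le_refl _)
  | ex3 a => exact H.equi_eq_one.2 (H.m5 a)

namespace Derives

variable {F : Type v} [Alg F] {Γ : Set F}

theorem mono {Δ : Set F} (hΓ : Γ ⊆ Δ) {φ : F} (h : Derives Γ φ) : Derives Δ φ := by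
  induction h with
  | hyp h => exact .hyp (hΓ h)
  | bl h => exact .bl h
  | monadic h => exact .monadic h
  | mp _ _ ih₁ ih₂ => exact .mp ih₁ ih₂
  | gen _ ih => exact .gen ih

theorem map {G : Type u} [Alg G] {h : F → G} (hh : IsHom h) {φ : F} (hφ : Derives Γ φ) :
    Derives (h '' Γ) (h φ) := by
  induction hφ with
  | hyp hφ => exact .hyp ⟨_, hφ, rfl⟩
  | bl hφ => exact .bl (hφ.map hh)
  | monadic hφ => exact .monadic (hφ.map hh)
  | mp _ _ ih₁ ih₂ => rw [hh.map_imp] at ih₂; exact .mp ih₁ ih₂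
  | gen _ ih => rw [hh.map_all]; exact .gen ih

theorem cut {Θ : Set F} {φ : F} (hΘ : ∀ ψ ∈ Θ, Derives Γ ψ) (h : Derives Θ φ) : Derives Γ φ := by
  induction h with
  | hyp h => exact hΘ _ h
  | bl h => exact .bl h
  | monadic h => exact .monadic h
  | mp _ _ ih₁ ih₂ => exact .mp ih₁ ih₂
  | gen _ ih => exact .gen ih

theorem finitary {φ : F} (h : Derives Γ φ) : ∃ Γ' ⊆ Γ, Γ'.Finite ∧ Derives Γ' φ := by
  induction h with
  | @hyp φ h =>
    exact ⟨{φ}, Set.singleton_subset_iff.2 h, Set.finite_singleton φ, .hyp rfl⟩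
  | bl h => exact ⟨∅, Set.empty_subset _, Set.finite_empty, .bl h⟩
  | monadic h => exact ⟨∅, Set.empty_subset _, Set.finite_empty, .monadic h⟩
  | mp _ _ ih₁ ih₂ =>
    obtain ⟨Γ₁, h₁, f₁, d₁⟩ := ih₁
    obtain ⟨Γ₂, h₂, f₂, d₂⟩ := ih₂
    exact ⟨Γ₁ ∪ Γ₂, Set.union_subset h₁ h₂, f₁.union f₂,
      .mp (d₁.mono Set.subset_union_left) (d₂.mono Set.subset_union_right)⟩
  | gen _ ih =>
    obtain ⟨Γ', h, f, d⟩ := ih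
    exact ⟨Γ', h, f, .gen d⟩

theorem isDeductiveSystem : IsDeductiveSystem (Derives (F := F)) where
  refl _ _ h := .hyp h
  cut _ _ _ hΘ h := h.cut hΘ
  finitary _ _ h := h.finitary
  structural _ hσ _ _ h := h.map hσ

/-- Generalization preserves the value `1` because `∀1 = 1`, so the rules may be applied to
consequences of `Γ` without restriction. -/
theorem sound {A : Type u} [Alg A] (H : IsMBL A) {h : F → A} (hh : IsHom h)
    (hΓ : ∀ γ ∈ Γ, h γ = Alg.one) {φ : F} (d : Derives Γ φ) : h φ = Alg.one := by
  induction d with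
  | hyp hφ => exact hΓ _ hφ
  | bl hφ => exact H.eq_one_of_blAxiom (hφ.map hh)
  | monadic hφ => exact H.eq_one_of_monadicAxiom (hφ.map hh)
  | mp _ _ ih₁ ih₂ =>
    rw [hh.map_imp, H.imp_eq_one, ih₁] at ih₂
    exact H.eq_one_of_le ih₂
  | gen _ ih => rw [hh.map_all, ih, H.all_one]

/-! ### Derived rules -/

variable {a b c d : F}

theorem trans (h : Derives Γ (a ⇒ₘ b)) (h' : Derives Γ (b ⇒ₘ c)) : Derives Γ (a ⇒ₘ c) :=
  .mp h' (.mp h (.bl (.a1 _ _ _)))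

theorem curry (h : Derives Γ (a ⊙ₘ b ⇒ₘ c)) : Derives Γ (a ⇒ₘ (b ⇒ₘ c)) :=
  .mp h (.bl (.a5b _ _ _))

theorem uncurry (h : Derives Γ (a ⇒ₘ (b ⇒ₘ c))) : Derives Γ (a ⊙ₘ b ⇒ₘ c) :=
  .mp h (.bl (.a5a _ _ _))

theorem star_comm (a b : F) : Derives Γ (a ⊙ₘ b ⇒ₘ b ⊙ₘ a) := .bl (.a3 _ _)

theorem swap (h : Derives Γ (a ⇒ₘ (b ⇒ₘ c))) : Derives Γ (b ⇒ₘ (a ⇒ₘ c)) :=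
  curry (trans (star_comm _ _) (uncurry h))

theorem weaken (b : F) (h : Derives Γ a) : Derives Γ (b ⇒ₘ a) :=
  .mp h (curry (.bl (.a2 _ _)))

/-- Weakening gives `a → ((0 → 0) → a)`; exchange the premises and detach `0 → 0`, an instance of ex
falso. -/
theorem refl (a : F) : Derives Γ (a ⇒ₘ a) :=
  .mp (.bl (.a7 Alg.zero)) (swap (curry (.bl (.a2 a (Alg.zero ⇒ₘ Alg.zero)))))

theorem residuation : Derives Γ (a ⊙ₘ c ⇒ₘ b) ↔ Derives Γ (c ⇒ₘ (a ⇒ₘ b)) :=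
  ⟨fun h => swap (curry h), fun h => uncurry (swap h)⟩

theorem star_imp (a b : F) : Derives Γ (a ⊙ₘ (a ⇒ₘ b) ⇒ₘ b) := residuation.2 (refl _)

theorem star_left (a : F) (h : Derives Γ (b ⇒ₘ c)) : Derives Γ (a ⊙ₘ b ⇒ₘ a ⊙ₘ c) :=
  residuation.2 (trans h (residuation.1 (refl _)))

theorem star_right (a : F) (h : Derives Γ (b ⇒ₘ c)) : Derives Γ (b ⊙ₘ a ⇒ₘ c ⊙ₘ a) :=
  trans (star_comm _ _) (trans (star_left a h) (star_comm _ _))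

theorem star_mono (h : Derives Γ (a ⇒ₘ b)) (h' : Derives Γ (c ⇒ₘ d)) :
    Derives Γ (a ⊙ₘ c ⇒ₘ b ⊙ₘ d) :=
  trans (star_left a h') (star_right d h)

theorem imp_mono (h : Derives Γ (b ⇒ₘ a)) (h' : Derives Γ (c ⇒ₘ d)) :
    Derives Γ ((a ⇒ₘ c) ⇒ₘ (b ⇒ₘ d)) :=
  residuation.1 (trans (star_right _ h) (trans (star_imp a c) h'))

theorem star_assoc (a b c : F) : Derives Γ ((a ⊙ₘ b) ⊙ₘ c ⇒ₘ a ⊙ₘ (b ⊙ₘ c)) :=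
  uncurry (uncurry (trans (curry (refl _)) (.bl (.a5b _ _ _))))

theorem star_assoc' (a b c : F) : Derives Γ (a ⊙ₘ (b ⊙ₘ c) ⇒ₘ (a ⊙ₘ b) ⊙ₘ c) :=
  uncurry (trans (curry (curry (refl _))) (.bl (.a5a _ _ _)))

theorem one : Derives Γ (Alg.one : F) := .mp (refl _) (.bl .one_mpr)

theorem one_star (a : F) : Derives Γ (a ⇒ₘ Alg.one ⊙ₘ a) :=
  .mp one (curry (refl _))

theorem one_star_le (a : F) : Derives Γ (Alg.one ⊙ₘ a ⇒ₘ a) :=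
  trans (star_comm _ _) (.bl (.a2 _ _))

theorem wedge_left (a b : F) : Derives Γ (a ⋏ₘ b ⇒ₘ a) :=
  trans (.bl (.wedge_mp _ _)) (.bl (.a2 _ _))

theorem wedge_right (a b : F) : Derives Γ (a ⋏ₘ b ⇒ₘ b) :=
  trans (.bl (.wedge_mp _ _)) (star_imp _ _)

theorem wedge_intro (h : Derives Γ (c ⇒ₘ a)) (h' : Derives Γ (c ⇒ₘ b)) :
    Derives Γ (c ⇒ₘ a ⋏ₘ b) := by
  -- As `c → a` is derivable, `c` yields `c * (c → a)`, which `a4` turns into `a * (a → c)`; this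
  -- implies `a * (a → b)`, that is, `a ∧ b`.
  have h₁ : Derives Γ (c ⇒ₘ c ⊙ₘ (c ⇒ₘ a)) :=
    .mp h (swap (curry (refl _)))
  exact trans h₁ (trans (.bl (.a4 _ _))
    (trans (star_left a (imp_mono (refl a) h')) (.bl (.wedge_mpr _ _))))

theorem vee_left (a b : F) : Derives Γ (a ⇒ₘ a ⋎ₘ b) :=
  trans (wedge_intro (swap (refl _)) (curry (.bl (.a2 _ _)))) (.bl (.vee_mpr _ _))

theorem vee_right (a b : F) : Derives Γ (b ⇒ₘ a ⋎ₘ b) :=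
  trans (wedge_intro (curry (.bl (.a2 _ _))) (swap (refl _))) (.bl (.vee_mpr _ _))

/-- Under `a → b` the disjunction collapses to `b`, under `b → a` to `a`; axiom `a6` merges the two
cases. -/
theorem vee_elim (h : Derives Γ (a ⇒ₘ c)) (h' : Derives Γ (b ⇒ₘ c)) :
    Derives Γ (a ⋎ₘ b ⇒ₘ c) := by
  have h₁ : Derives Γ ((a ⇒ₘ b) ⇒ₘ (a ⋎ₘ b ⇒ₘ c)) :=
    swap (trans (trans (.bl (.vee_mp _ _)) (wedge_left _ _)) (imp_mono (refl _) h'))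
  have h₂ : Derives Γ ((b ⇒ₘ a) ⇒ₘ (a ⋎ₘ b ⇒ₘ c)) :=
    swap (trans (trans (.bl (.vee_mp _ _)) (wedge_right _ _)) (imp_mono (refl _) h))
  exact .mp h₂ (.mp h₁ (.bl (.a6 _ _ _)))

theorem prelinearity (a b : F) : Derives Γ ((a ⇒ₘ b) ⋎ₘ (b ⇒ₘ a)) :=
  -- `a6` is used with the disjunction itself as conclusion.
  .mp (vee_right _ _) (.mp (vee_left _ _) (.bl (.a6 a b _)))

theorem all_intro (ha : Modal a) (h : Derives Γ (a ⇒ₘ b)) : Derives Γ (a ⇒ₘ Alg.all b) :=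
  .mp (.gen h) (.monadic (.all2 _ _ ha))

theorem all_elim (a : F) : Derives Γ (Alg.all a ⇒ₘ a) := .monadic (.all1 _)

theorem all_mono (h : Derives Γ (a ⇒ₘ b)) : Derives Γ (Alg.all a ⇒ₘ Alg.all b) :=
  all_intro (.all a) (trans (all_elim a) h)

theorem ex_intro (a : F) : Derives Γ (a ⇒ₘ Alg.ex a) := .monadic (.ex1 _)

theorem ex_mono (h : Derives Γ (a ⇒ₘ b)) : Derives Γ (Alg.ex a ⇒ₘ Alg.ex b) :=
  .mp (.gen (trans h (ex_intro b))) (.monadic (.ex2 _ _ (.ex b)))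

theorem equi_left (h : Derives Γ (Alg.equi a b)) : Derives Γ (a ⇒ₘ b) := .mp h (wedge_left _ _)

theorem equi_right (h : Derives Γ (Alg.equi a b)) : Derives Γ (b ⇒ₘ a) := .mp h (wedge_right _ _)

end Derives

/-! ### The Lindenbaum–Tarski algebra -/

/-- Provable equivalence. -/
def provEquiv {F : Type} [Alg F] (Γ : Set F) : Setoid F where
  r a b := Derives Γ (a ⇒ₘ b) ∧ Derives Γ (b ⇒ₘ a)
  iseqv :=
    { refl := fun a => ⟨.refl a, .refl a⟩
      symm := fun h => ⟨h.2, h.1⟩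
      trans := fun h h' => ⟨h.1.trans h'.1, h'.2.trans h.2⟩ }

/-- The Lindenbaum–Tarski algebra of the theory `Γ`, in an arbitrary universe. -/
def Lindenbaum {F : Type} [Alg F] (Γ : Set F) : Type u := ULift.{u} (Quotient (provEquiv Γ))

namespace Lindenbaum

variable {F : Type} [Alg F] {Γ : Set F}

/-- The class of a formula. -/
def mk (Γ : Set F) (a : F) : Lindenbaum.{u} Γ := ULift.up (Quotient.mk (provEquiv Γ) a)

theorem mk_surjective : Function.Surjective (mk.{u} Γ) := by
  rintro ⟨q⟩
  obtain ⟨a, rfl⟩ := Quotient.exists_rep q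
  exact ⟨a, rfl⟩

theorem mk_eq_mk {a b : F} :
    mk.{u} Γ a = mk Γ b ↔ Derives Γ (a ⇒ₘ b) ∧ Derives Γ (b ⇒ₘ a) :=
  ULift.up_inj.trans Quotient.eq

/-- A unary operation that respects provable equivalence. -/
def lift₁ (f : F → F) (hf : ∀ a b, Derives Γ (a ⇒ₘ b) → Derives Γ (f a ⇒ₘ f b))
    (x : Lindenbaum.{u} Γ) : Lindenbaum.{u} Γ :=
  ULift.up (Quotient.map (sa := provEquiv Γ) (sb := provEquiv Γ) f
    (fun _ _ h => ⟨hf _ _ h.1, hf _ _ h.2⟩) x.down)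

/-- A binary operation that respects provable equivalence. -/
def lift₂ (f : F → F → F)
    (hf : ∀ a a' b b', Derives Γ (a ⇒ₘ a') → Derives Γ (a' ⇒ₘ a) → Derives Γ (b ⇒ₘ b') →
      Derives Γ (f a b ⇒ₘ f a' b'))
    (x y : Lindenbaum.{u} Γ) : Lindenbaum.{u} Γ :=
  ULift.up (Quotient.map₂ (sa := provEquiv Γ) (sb := provEquiv Γ) (sc := provEquiv Γ) f
    (fun _ _ h _ _ h' => ⟨hf _ _ _ _ h.1 h.2 h'.1, hf _ _ _ _ h.2 h.1 h'.2⟩) x.down y.down)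

/-- Well-definedness is monotonicity of each connective; only `→`, antitone in its first argument,
uses the converse derivation there. -/
instance : Alg (Lindenbaum.{u} Γ) where
  vee := lift₂ (· ⋎ₘ ·) fun _ _ _ _ h _ h' =>
    .vee_elim (h.trans (.vee_left _ _)) (h'.trans (.vee_right _ _))
  wedge := lift₂ (· ⋏ₘ ·) fun _ _ _ _ h _ h' =>
    .wedge_intro (.trans (.wedge_left _ _) h) (.trans (.wedge_right _ _) h')
  star := lift₂ (· ⊙ₘ ·) fun _ _ _ _ h _ h' => h.star_mono h'
  imp := lift₂ (· ⇒ₘ ·) fun _ _ _ _ _ h h' => h.imp_mono h'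
  ex := lift₁ Alg.ex fun _ _ h => h.ex_mono
  all := lift₁ Alg.all fun _ _ h => h.all_mono
  zero := mk Γ Alg.zero
  one := mk Γ Alg.one

theorem isHom_mk : IsHom (mk.{u} Γ) where
  map_vee _ _ := rfl
  map_wedge _ _ := rfl
  map_star _ _ := rfl
  map_imp _ _ := rfl
  map_ex _ := rfl
  map_all _ := rfl
  map_zero := rfl
  map_one := rfl

theorem mk_eq_one {a : F} : mk.{u} Γ a = Alg.one ↔ Derives Γ a :=
  (mk_eq_mk (b := Alg.one)).trans
    ⟨fun h => .mp .one h.2, fun h => ⟨Derives.one.weaken a, h.weaken _⟩⟩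

/-- Defining the order by implication makes every BL law a statement about derivable implications.
-/
instance : PartialOrder (Lindenbaum.{u} Γ) where
  le x y := (x ⇒ₘ y) = Alg.one
  le_refl x := by
    obtain ⟨a, rfl⟩ := mk_surjective x
    exact mk_eq_one.2 (.refl a)
  le_trans x y z h h' := by
    obtain ⟨a, rfl⟩ := mk_surjective x
    obtain ⟨b, rfl⟩ := mk_surjective y
    obtain ⟨c, rfl⟩ := mk_surjective z
    exact mk_eq_one.2 ((mk_eq_one.1 h).trans (mk_eq_one.1 h'))
  le_antisymm x y h h' := by
    obtain ⟨a, rfl⟩ := mk_surjective x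
    obtain ⟨b, rfl⟩ := mk_surjective y
    exact mk_eq_mk.2 ⟨mk_eq_one.1 h, mk_eq_one.1 h'⟩

theorem mk_le_mk {a b : F} : mk.{u} Γ a ≤ mk Γ b ↔ Derives Γ (a ⇒ₘ b) := mk_eq_one

theorem isBL : IsBL (Lindenbaum.{u} Γ) := by
  apply IsBL.of_partialOrder
  · refine mk_surjective.forall₃.2 fun a b c => ?_
    exact (mk_le_mk (a := a ⋎ₘ b)).trans <| Iff.trans
      ⟨fun h => ⟨.trans (.vee_left _ _) h, .trans (.vee_right _ _) h⟩, fun h => h.1.vee_elim h.2⟩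
      (and_congr mk_le_mk mk_le_mk).symm
  · refine mk_surjective.forall₃.2 fun a b c => ?_
    exact (mk_le_mk (b := a ⋏ₘ b)).trans <| Iff.trans
      ⟨fun h => ⟨h.trans (.wedge_left _ _), h.trans (.wedge_right _ _)⟩,
        fun h => h.1.wedge_intro h.2⟩
      (and_congr mk_le_mk mk_le_mk).symm
  · exact mk_surjective.forall.2 fun a => mk_le_mk.2 (.bl (.a7 a))
  · exact mk_surjective.forall.2 fun a => mk_le_mk.2 (Derives.one.weaken a)
  · exact mk_surjective.forall₂.2 fun a b => mk_eq_mk.2 ⟨.star_comm _ _, .star_comm _ _⟩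
  · exact mk_surjective.forall₃.2 fun a b c => mk_eq_mk.2 ⟨.star_assoc _ _ _, .star_assoc' _ _ _⟩
  · exact mk_surjective.forall.2 fun a => mk_eq_mk.2 ⟨.one_star_le a, .one_star a⟩
  · refine mk_surjective.forall₃.2 fun a b c => ?_
    exact (mk_le_mk (a := a ⊙ₘ c)).trans <| Derives.residuation.trans
      (mk_le_mk (b := a ⇒ₘ b)).symm
  · exact mk_surjective.forall₂.2 fun a b => mk_eq_mk.2 ⟨.bl (.wedge_mp _ _), .bl (.wedge_mpr _ _)⟩
  · exact mk_surjective.forall₂.2 fun a b => mk_eq_one.2 (.prelinearity a b)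

/-- In `m2`–`m4` one inequality is a quantifier axiom with `ν` a quantified formula; the other is
`all_intro`, available because the right-hand side is modal. -/
theorem isMBL : IsMBL (Lindenbaum.{u} Γ) where
  toIsBL := isBL
  m1 := mk_surjective.forall.2 fun a => mk_eq_one.2 (.all_elim a)
  m2 := mk_surjective.forall₂.2 fun a b => mk_eq_mk.2
    ⟨.monadic (.ex2 _ _ (.all b)),
      .all_intro (.imp (.ex a) (.all b)) (.imp_mono (.ex_intro a) (.refl _))⟩
  m3 := mk_surjective.forall₂.2 fun a b => mk_eq_mk.2
    ⟨.monadic (.all2 _ _ (.all a)),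
      .all_intro (.imp (.all a) (.all b)) (.imp_mono (.refl _) (.all_elim b))⟩
  m4 := mk_surjective.forall₂.2 fun a b => mk_eq_mk.2
    ⟨.monadic (.all3 _ _ (.ex a)),
      .all_intro (.vee (.ex a) (.all b))
        (.vee_elim (.vee_left _ _) (.trans (.all_elim b) (.vee_right _ _)))⟩
  m5 := mk_surjective.forall.2 fun a => mk_eq_mk.2
    ⟨.equi_left (.monadic (.ex3 a)), .equi_right (.monadic (.ex3 a))⟩

end Lindenbaum

/-! ### Algebraization -/

/-- For completeness, the quotient map into the algebra of `Γ` itself satisfies all premises, so no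
deduction theorem is needed. -/
theorem derives_iff_eqConseq {F : Type} [Alg F] (Γ : Set F) (φ : F) :
    Derives Γ φ ↔ EqConseq MBL.{u} {p | ∃ γ ∈ Γ, p = (γ, Alg.one)} (φ, Alg.one) := by
  constructor
  · intro d A _ H h hh hE
    have hone : h Alg.one = Alg.one := hh.map_one
    have := d.sound H hh fun γ hγ => (hE (γ, Alg.one) ⟨γ, hγ, rfl⟩).trans hone
    exact this.trans hone.symm
  · intro h
    refine Lindenbaum.mk_eq_one.{u}.1
      (h (Lindenbaum.{u} Γ) _ Lindenbaum.isMBL (Lindenbaum.mk Γ) Lindenbaum.isHom_mk ?_)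
    rintro _ ⟨γ, hγ, rfl⟩
    exact Lindenbaum.mk_eq_one.2 (.hyp hγ)

theorem eqConseq_equi {F : Type v} [Alg F] (φ ψ : F) :
    EqConseq MBL.{u} {(φ, ψ)} (Alg.equi φ ψ, Alg.one) := by
  intro A _ H h hh hE
  have heq : h φ = h ψ := hE _ rfl
  change h (Alg.equi φ ψ) = h Alg.one
  rw [Alg.equi_map hh, hh.map_one]
  exact H.equi_eq_one.2 heq

theorem eqConseq_of_equi {F : Type v} [Alg F] (φ ψ : F) :
    EqConseq MBL.{u} {(Alg.equi φ ψ, Alg.one)} (φ, ψ) := by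
  intro A _ H h hh hE
  have heq : h (Alg.equi φ ψ) = h Alg.one := hE _ rfl
  rw [Alg.equi_map hh, hh.map_one] at heq
  exact H.equi_eq_one.1 heq

theorem defEqs_tauOne {F : Type v} [Alg F] (φ : F) : defEqs tauOne φ = {(φ, Alg.one)} := by
  ext p
  simp [defEqs, tauOne, Term.eval]

theorem eval_equi {F : Type v} [Alg F] (φ ψ : F) :
    (Alg.equi (Term.var 0) (Term.var 1) : Term (Fin 2)).eval ![φ, ψ] = Alg.equi φ ψ := rfl

theorem isEquivAlgSemantics_derives {F : Type} [Alg F] :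
    IsEquivAlgSemantics MBL.{u} (Derives (F := F)) tauOne deltaEqui where
  deductive := Derives.isDeductiveSystem
  algebraic Γ φ := by
    have hE : (⋃ γ ∈ Γ, defEqs tauOne γ) = {p | ∃ γ ∈ Γ, p = (γ, Alg.one)} := by
      ext p
      simp [defEqs_tauOne]
    rw [hE, derives_iff_eqConseq.{u}, defEqs_tauOne]
    simp
  equiv_mp φ ψ t ht eqn h := by
    obtain rfl := Finset.mem_singleton.1 ht
    rw [eval_equi, defEqs_tauOne, Set.mem_singleton_iff] at h
    rw [h]
    exact eqConseq_equi φ ψ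
  equiv_mpr φ ψ := by
    simp only [deltaEqui, Finset.mem_singleton, Set.iUnion_iUnion_eq_left, eval_equi,
      defEqs_tauOne]
    exact eqConseq_of_equi φ ψ

/-! ### S5(BL) and mBL∀ -/

theorem Fm.isModal_iff {φ : Fm} : φ.IsModal ↔ Modal φ := by
  constructor
  · intro h
    induction h with
    | box φ => exact .all φ
    | dia φ => exact .ex φ
    | zero => exact .zero
    | one => exact .one
    | vee _ _ h h' => exact .vee h h'
    | wedge _ _ h h' => exact .wedge h h'
    | star _ _ h h' => exact .star h h'
    | imp _ _ h h' => exact .imp h h'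
  · intro h
    induction h with
    | all φ => exact .box φ
    | ex φ => exact .dia φ
    | zero => exact .zero
    | one => exact .one
    | vee _ _ h h' => exact .vee h h'
    | wedge _ _ h h' => exact .wedge h h'
    | star _ _ h h' => exact .star h h'
    | imp _ _ h h' => exact .imp h h'

theorem s5Axiom_iff {φ : Fm} : S5Axiom φ ↔ MonadicAxiom φ := by
  constructor
  · intro h
    cases h with
    | box1 φ => exact .all1 φ
    | dia1 φ => exact .ex1 φ
    | box2 ν φ h => exact .all2 ν φ (Fm.isModal_iff.1 h)
    | dia2 ν φ h => exact .ex2 ν φ (Fm.isModal_iff.1 h)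
    | box3 ν φ h => exact .all3 ν φ (Fm.isModal_iff.1 h)
    | dia3 φ => exact .ex3 φ
  · intro h
    cases h with
    | all1 φ => exact .box1 φ
    | ex1 φ => exact .dia1 φ
    | all2 ν φ h => exact .box2 ν φ (Fm.isModal_iff.2 h)
    | ex2 ν φ h => exact .dia2 ν φ (Fm.isModal_iff.2 h)
    | all3 ν φ h => exact .box3 ν φ (Fm.isModal_iff.2 h)
    | ex3 φ => exact .dia3 φ

theorem s5_eq_derives : S5 = Derives := by
  ext Γ φ
  constructor
  · intro h
    induction h with
    | hyp h => exact .hyp h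
    | bl h => exact .bl h
    | modal h => exact .monadic (s5Axiom_iff.1 h)
    | mp _ _ h h' => exact .mp h h'
    | nec _ h => exact .gen h
  · intro h
    induction h with
    | hyp h => exact .hyp h
    | bl h => exact .bl h
    | monadic h => exact .modal (s5Axiom_iff.2 h)
    | mp _ _ h h' => exact .mp h h'
    | gen _ h => exact .nec h

/-- Every atom `Pᵢ(x)` contains `x` free, so only quantifiers and the truth constants can start a
formula without free `x`. -/
theorem MonFm.not_xFree_iff {φ : MonFm} : ¬ φ.XFree ↔ Modal φ := by
  constructor
  · intro h
    induction φ with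
    | pred i => exact (h trivial).elim
    | vee _ _ ih ih' => exact .vee (ih fun k => h (.inl k)) (ih' fun k => h (.inr k))
    | wedge _ _ ih ih' => exact .wedge (ih fun k => h (.inl k)) (ih' fun k => h (.inr k))
    | star _ _ ih ih' => exact .star (ih fun k => h (.inl k)) (ih' fun k => h (.inr k))
    | imp _ _ ih ih' => exact .imp (ih fun k => h (.inl k)) (ih' fun k => h (.inr k))
    | ex φ => exact .ex φ
    | all φ => exact .all φ
    | zero => exact .zero
    | one => exact .one
  · intro h
    induction h with
    | all φ => exact id
    | ex φ => exact id
    | zero => exact id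
    | one => exact id
    | vee _ _ h h' => exact fun k => k.elim h h'
    | wedge _ _ h h' => exact fun k => k.elim h h'
    | star _ _ h h' => exact fun k => k.elim h h'
    | imp _ _ h h' => exact fun k => k.elim h h'

theorem monAxiom_iff {φ : MonFm} : MonAxiom φ ↔ MonadicAxiom φ := by
  constructor
  · intro h
    cases h with
    | all1 φ => exact .all1 φ
    | ex1 φ => exact .ex1 φ
    | all2 ν φ h => exact .all2 ν φ (MonFm.not_xFree_iff.1 h)
    | ex2 ν φ h => exact .ex2 ν φ (MonFm.not_xFree_iff.1 h)
    | all3 ν φ h => exact .all3 ν φ (MonFm.not_xFree_iff.1 h)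
    | ex3 φ => exact .ex3 φ
  · intro h
    cases h with
    | all1 φ => exact .all1 φ
    | ex1 φ => exact .ex1 φ
    | all2 ν φ h => exact .all2 ν φ (MonFm.not_xFree_iff.2 h)
    | ex2 ν φ h => exact .ex2 ν φ (MonFm.not_xFree_iff.2 h)
    | all3 ν φ h => exact .all3 ν φ (MonFm.not_xFree_iff.2 h)
    | ex3 φ => exact .ex3 φ

theorem monBL_eq_derives : MonBL = Derives := by
  ext Γ φ
  constructor
  · intro h
    induction h with
    | hyp h => exact .hyp h
    | bl h => exact .bl h
    | quant h => exact .monadic (monAxiom_iff.1 h)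
    | mp _ _ h h' => exact .mp h h'
    | gen _ h => exact .gen h
  · intro h
    induction h with
    | hyp h => exact .hyp h
    | bl h => exact .bl h
    | monadic h => exact .quant (monAxiom_iff.2 h)
    | mp _ _ h h' => exact .mp h h'
    | gen _ h => exact .gen h

theorem Fm.isHom_toMon : IsHom Fm.toMon where
  map_vee _ _ := rfl
  map_wedge _ _ := rfl
  map_star _ _ := rfl
  map_imp _ _ := rfl
  map_ex _ := rfl
  map_all _ := rfl
  map_zero := rfl
  map_one := rfl

/-- The inverse of the translation `Fm.toMon`. -/
def MonFm.toFm : MonFm → Fm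
  | pred i => Fm.prop i
  | vee φ ψ => Fm.vee φ.toFm ψ.toFm
  | wedge φ ψ => Fm.wedge φ.toFm ψ.toFm
  | star φ ψ => Fm.star φ.toFm ψ.toFm
  | imp φ ψ => Fm.imp φ.toFm ψ.toFm
  | ex φ => Fm.dia φ.toFm
  | all φ => Fm.box φ.toFm
  | zero => Fm.zero
  | one => Fm.one

theorem MonFm.isHom_toFm : IsHom MonFm.toFm where
  map_vee _ _ := rfl
  map_wedge _ _ := rfl
  map_star _ _ := rfl
  map_imp _ _ := rfl
  map_ex _ := rfl
  map_all _ := rfl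
  map_zero := rfl
  map_one := rfl

theorem Fm.toFm_toMon : Function.LeftInverse MonFm.toFm Fm.toMon := by
  intro φ
  induction φ <;> simp_all [Fm.toMon, MonFm.toFm]

theorem MonFm.toMon_toFm : Function.RightInverse MonFm.toFm Fm.toMon := by
  intro φ
  induction φ <;> simp_all [Fm.toMon, MonFm.toFm]

/-- The translation and its inverse are both homomorphisms, and derivations are transported along
homomorphisms. -/
theorem s5_iff_monBL (Γ : Set Fm) (φ : Fm) : S5 Γ φ ↔ MonBL (Fm.toMon '' Γ) φ.toMon := by
  rw [s5_eq_derives, monBL_eq_derives]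
  refine ⟨Derives.map Fm.isHom_toMon, fun h => ?_⟩
  have := h.map MonFm.isHom_toFm
  rwa [Fm.toFm_toMon.image_image, Fm.toFm_toMon] at this

/-! ### The variety of monadic BL-algebras -/

/-- In the presence of the lattice laws and divisibility, residuation is equational. -/
theorem residuation_of_identities {A : Type u} [Alg A]
    (vee_wedge_self : ∀ a b : A, a ⋎ₘ (a ⋏ₘ b) = a)
    (wedge_vee_self : ∀ a b : A, a ⋏ₘ (a ⋎ₘ b) = a)
    (vee_comm : ∀ a b : A, a ⋎ₘ b = b ⋎ₘ a)
    (wedge_comm : ∀ a b : A, a ⋏ₘ b = b ⋏ₘ a)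
    (wedge_assoc : ∀ a b c : A, (a ⋏ₘ b) ⋏ₘ c = a ⋏ₘ (b ⋏ₘ c))
    (divisibility : ∀ a b : A, a ⋏ₘ b = a ⊙ₘ (a ⇒ₘ b))
    (unit : ∀ a c : A, c ⋏ₘ (a ⇒ₘ a ⊙ₘ c) = c)
    (imp_mono : ∀ a b c : A, (a ⇒ₘ b) ⋏ₘ (a ⇒ₘ b ⋎ₘ c) = (a ⇒ₘ b))
    (star_mono : ∀ a b c : A, (a ⊙ₘ b) ⋏ₘ (a ⊙ₘ (b ⋎ₘ c)) = a ⊙ₘ b) (a b c : A) :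
    Alg.le (a ⊙ₘ c) b ↔ Alg.le c (a ⇒ₘ b) := by
  have vee_eq {x y : A} (h : x ⋏ₘ y = x) : x ⋎ₘ y = y := by
    rw [← h, wedge_comm x y, vee_comm, vee_wedge_self]
  have le_trans {x y z : A} (h : x ⋏ₘ y = x) (h' : y ⋏ₘ z = y) : x ⋏ₘ z = x := by
    rw [← h, wedge_assoc, h']
  constructor
  · intro h
    -- Since `(a * c) ∨ b = b`, the identity becomes `a → a * c ≤ a → b`.
    have h' := imp_mono a (a ⊙ₘ c) b
    rw [vee_eq h] at h'
    exact le_trans (unit a c) h'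
  · intro h
    -- Likewise `a * c ≤ a * (a → b) = a ∧ b`.
    have h' := star_mono a c (a ⇒ₘ b)
    rw [vee_eq h, ← divisibility] at h'
    refine le_trans h' ?_
    rw [wedge_comm a b, wedge_comm, ← wedge_assoc]
    have hb := wedge_vee_self b (b ⋏ₘ b)
    rw [vee_wedge_self] at hb
    rw [hb]

/-- The defining set consists of all identities valid in the class, so only the converse needs work:
each axiom must follow from valid identities. -/
theorem isVariety_mbl : IsVariety MBL.{u} := by
  refine ⟨{p | ∀ (A : Type u) (inst : Alg A), MBL A inst → ∀ e : ℕ → A, p.1.eval e = p.2.eval e},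
    fun A inst => ⟨fun H p hp e => hp A inst H e, fun h => ?_⟩⟩
  -- All variables from index 2 on receive `c`; three variables suffice for the axioms.
  let e (a b c : A) : ℕ → A := fun n => if n = 0 then a else if n = 1 then b else c
  let x : Term ℕ := .var 0
  let y : Term ℕ := .var 1
  let z : Term ℕ := .var 2
  have key (s t : Term ℕ) (hst : ∀ (B : Type u) [Alg B], IsMBL B → ∀ e : ℕ → B,
      s.eval e = t.eval e) (a b c : A) : s.eval (e a b c) = t.eval (e a b c) :=
    h (s, t) (fun B _ H e => hst B H e) (e a b c)
  have vee_comm (a b : A) : a ⋎ₘ b = b ⋎ₘ a :=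
    key (x ⋎ₘ y) (y ⋎ₘ x) (fun B _ H e => H.vee_comm _ _) a b b
  have wedge_comm (a b : A) : a ⋏ₘ b = b ⋏ₘ a :=
    key (x ⋏ₘ y) (y ⋏ₘ x) (fun B _ H e => H.wedge_comm _ _) a b b
  have wedge_assoc (a b c : A) : (a ⋏ₘ b) ⋏ₘ c = a ⋏ₘ (b ⋏ₘ c) :=
    key ((x ⋏ₘ y) ⋏ₘ z) (x ⋏ₘ (y ⋏ₘ z)) (fun B _ H e => H.wedge_assoc _ _ _) a b c
  have vee_wedge_self (a b : A) : a ⋎ₘ (a ⋏ₘ b) = a :=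
    key (x ⋎ₘ (x ⋏ₘ y)) x (fun B _ H e => H.vee_wedge_self _ _) a b b
  have wedge_vee_self (a b : A) : a ⋏ₘ (a ⋎ₘ b) = a :=
    key (x ⋏ₘ (x ⋎ₘ y)) x (fun B _ H e => H.wedge_vee_self _ _) a b b
  have divisibility (a b : A) : a ⋏ₘ b = a ⊙ₘ (a ⇒ₘ b) :=
    key (x ⋏ₘ y) (x ⊙ₘ (x ⇒ₘ y)) (fun B _ H e => H.divisibility _ _) a b b
  exact
    { vee_comm := vee_comm
      vee_assoc := key ((x ⋎ₘ y) ⋎ₘ z) (x ⋎ₘ (y ⋎ₘ z)) fun B _ H e => H.vee_assoc _ _ _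
      wedge_comm := wedge_comm
      wedge_assoc := wedge_assoc
      vee_wedge_self := vee_wedge_self
      wedge_vee_self := wedge_vee_self
      zero_le := fun a => key (Alg.zero ⋏ₘ x) Alg.zero (fun B _ H e => H.zero_le _) a a a
      le_one := fun a => key (x ⋏ₘ Alg.one) x (fun B _ H e => H.le_one _) a a a
      star_comm := fun a b => key (x ⊙ₘ y) (y ⊙ₘ x) (fun B _ H e => H.star_comm _ _) a b b
      star_assoc := key ((x ⊙ₘ y) ⊙ₘ z) (x ⊙ₘ (y ⊙ₘ z)) fun B _ H e => H.star_assoc _ _ _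
      one_star := fun a => key (Alg.one ⊙ₘ x) x (fun B _ H e => H.one_star _) a a a
      residuation := residuation_of_identities vee_wedge_self wedge_vee_self vee_comm wedge_comm
        wedge_assoc divisibility
        (fun a c => key (y ⋏ₘ (x ⇒ₘ x ⊙ₘ y)) y
          (fun B _ H e => (H.residuation _ _ _).1 (H.le_refl _)) a c c)
        (key ((x ⇒ₘ y) ⋏ₘ (x ⇒ₘ y ⋎ₘ z)) (x ⇒ₘ y)
          fun B _ H e => H.imp_le_imp_right _ (H.le_vee_left _ _))
        (key ((x ⊙ₘ y) ⋏ₘ (x ⊙ₘ (y ⋎ₘ z))) (x ⊙ₘ y)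
          fun B _ H e => H.star_le_star_left _ (H.le_vee_left _ _))
      divisibility := divisibility
      prelinearity := fun a b => key ((x ⇒ₘ y) ⋎ₘ (y ⇒ₘ x)) Alg.one
        (fun B _ H e => H.prelinearity _ _) a b b
      m1 := fun a => key (Alg.all x ⇒ₘ x) Alg.one (fun B _ H e => H.m1 _) a a a
      m2 := fun a b => key (Alg.all (x ⇒ₘ Alg.all y)) (Alg.ex x ⇒ₘ Alg.all y)
        (fun B _ H e => H.m2 _ _) a b b
      m3 := fun a b => key (Alg.all (Alg.all x ⇒ₘ y)) (Alg.all x ⇒ₘ Alg.all y)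
        (fun B _ H e => H.m3 _ _) a b b
      m4 := fun a b => key (Alg.all (Alg.ex x ⋎ₘ y)) (Alg.ex x ⋎ₘ Alg.all y)
        (fun B _ H e => H.m4 _ _) a b b
      m5 := fun a => key (Alg.ex (x ⊙ₘ x)) (Alg.ex x ⊙ₘ Alg.ex x)
        (fun B _ H e => H.m5 _) a a a }

end MonadicBL

/-- The variety of monadic BL-algebras is the equivalent algebraic semantics (Blok–Pigozzi) of
S5(BL) and of mBL∀, with defining equation `x ≈ 1` and equivalence formula `(x → y) ∧ (y → x)`. -/
theorem mainTheorem1 :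
    IsVariety MBL.{u} ∧
    -- algebraization of S5(BL)
    IsEquivAlgSemantics MBL.{u} S5 tauOne deltaEqui ∧
    -- the same, spelled out
    (∀ (Γ : Set Fm) (φ : Fm),
      S5 Γ φ ↔ EqConseq MBL.{u} {p | ∃ γ ∈ Γ, p = (γ, Alg.one)} (φ, Alg.one)) ∧
    (∀ φ ψ : Fm,
      EqConseq MBL.{u} {(φ, ψ)} ((φ ⇒ₘ ψ) ⋏ₘ (ψ ⇒ₘ φ), Alg.one) ∧
      EqConseq MBL.{u} {((φ ⇒ₘ ψ) ⋏ₘ (ψ ⇒ₘ φ), Alg.one)} (φ, ψ)) ∧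
    -- the monadic predicate logic, with the modal logic as its notational counterpart
    (Function.Bijective Fm.toMon ∧
      ∀ (Γ : Set Fm) (φ : Fm), S5 Γ φ ↔ MonBL (Fm.toMon '' Γ) φ.toMon) ∧
    IsEquivAlgSemantics MBL.{u} MonBL tauOne deltaEqui := by
  refine ⟨isVariety_mbl, ?_, fun Γ φ => ?_, fun φ ψ => ⟨eqConseq_equi φ ψ, eqConseq_of_equi φ ψ⟩,
    ⟨⟨Fm.toFm_toMon.injective, MonFm.toMon_toFm.surjective⟩, s5_iff_monBL⟩, ?_⟩
  · rw [s5_eq_derives]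
    exact isEquivAlgSemantics_derives
  · rw [s5_eq_derives]
    exact derives_iff_eqConseq Γ φ
  · rw [monBL_eq_derives]
    exact isEquivAlgSemantics_derives
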